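/- For a domain (nonempty connected open set) $D\subset\mathbb C^n$ let $$l_D(z,w)=\inf\{\tanh^{-1}|\alpha|:\ \exists\,\varphi\in\mathcal O(\mathbb D,D),\ \alpha\in\mathbb D,\ \varphi(0)=z,\ \varphi(\alpha)=w\}$$ be the Lempert function ($\mathbb D$ is the unit disc), and let the Kobayashi pseudodistance $k_D$ be the largest pseudodistance on $D$ not exceeding $l_D$. Let $d_D(u)=\operatorname{dist}(u,\partial D)$, and let $$h_D(z,w)=\inf_\gamma\int_\gamma\frac{|du|}{d_D(u)}$$ be the quasi-hyperbolic distance, where the infimum is over all rectifiable curves $\gamma$ in $D$ joining $z$ to $w$. A point $a\in\partial D$ is called $\mathcal C^1$-smooth if there are a neighbourhood $U$ of $a$ and a real-valued $\mathcal C^1$ function $r$ on $U$ with $dr(a)\ne 0$ and $D\cap U=\{x\in U: r(x)<0\}$; $D$ is called $\mathcal C^1$-smooth if all its boundary points are $\mathcal C^1$-smooth. (a) If $a$ is a $\mathcal C^1$-smooth boundary point of a domain $D\subset\mathbb C^n$, then $$\limsup_{\substack{z,w\to a\\ z,w\in D,\ z\ne w}}\frac{k_D(z,w)}{h_D(z,w)}\le\frac12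 .$$ (b) If $D\subset\mathbb C^n$ is a $\mathcal C^1$-smooth bounded domain, then $$\limsup_{z\to\partial D}\frac{k_D(z,w)}{h_D(z,w)}\le\frac12\quad\text{uniformly in } w\in D,\ w\ne z,$$ that is, $\displaystyle\limsup_{D\ni z\to\partial D}\ \sup_{w\in D\setminus\{z\}}\frac{k_D(z,w)}{h_D(z,w)}\le\frac12 .$ -/

import Mathlib

open Set Filter Topology
open scoped ENNReal

noncomputable section

/-- `a` is a `C¹`-smooth boundary point of `D ⊆ ℂⁿ`: near `a`, the set `D` is `{r < 0}` for some
`C¹` function `r` (in the real sense) with nonvanishing differential at `a`. -/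
def IsC1BoundaryPoint {n : ℕ} (D : Set (EuclideanSpace ℂ (Fin n)))
    (a : EuclideanSpace ℂ (Fin n)) : Prop :=
  a ∈ frontier D ∧
    ∃ (U : Set (EuclideanSpace ℂ (Fin n))) (r : EuclideanSpace ℂ (Fin n) → ℝ),
      IsOpen U ∧ a ∈ U ∧ ContDiffOn ℝ 1 r U ∧ fderiv ℝ r a ≠ 0 ∧ D ∩ U = {x ∈ U | r x < 0}

/-- The Lempert function of `D`: the infimum of `tanh⁻¹ |α|` over the holomorphic maps `φ` of the
unit disc into `D` with `φ 0 = z` and `φ α = w` (the infimum of the empty set being `∞`). -/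
def lempert {n : ℕ} (D : Set (EuclideanSpace ℂ (Fin n)))
    (z w : EuclideanSpace ℂ (Fin n)) : ℝ≥0∞ :=
  ⨅ (φ : ℂ → EuclideanSpace ℂ (Fin n)) (α : ℂ)
    (_ : DifferentiableOn ℂ φ (Metric.ball 0 1) ∧ MapsTo φ (Metric.ball 0 1) D ∧
      α ∈ Metric.ball (0 : ℂ) 1 ∧ φ 0 = z ∧ φ α = w),
    ENNReal.ofReal (Real.artanh ‖α‖)

/-- `ρ` is a (finite-valued) pseudodistance on the set `D`. -/
structure IsPseudodistanceOn {n : ℕ} (D : Set (EuclideanSpace ℂ (Fin n)))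
    (ρ : EuclideanSpace ℂ (Fin n) → EuclideanSpace ℂ (Fin n) → ℝ) : Prop where
  nonneg : ∀ x ∈ D, ∀ y ∈ D, 0 ≤ ρ x y
  refl : ∀ x ∈ D, ρ x x = 0
  symm : ∀ x ∈ D, ∀ y ∈ D, ρ x y = ρ y x
  triangle : ∀ x ∈ D, ∀ y ∈ D, ∀ u ∈ D, ρ x u ≤ ρ x y + ρ y u

/-- The Kobayashi pseudodistance of `D`: the largest pseudodistance on `D` not exceeding the
Lempert function, i.e. the supremum of all such pseudodistances. -/
def kobayashi {n : ℕ} (D : Set (EuclideanSpace ℂ (Fin n)))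
    (z w : EuclideanSpace ℂ (Fin n)) : ℝ≥0∞ :=
  ⨆ (ρ : EuclideanSpace ℂ (Fin n) → EuclideanSpace ℂ (Fin n) → ℝ)
    (_ : IsPseudodistanceOn D ρ ∧
      ∀ x ∈ D, ∀ y ∈ D, ENNReal.ofReal (ρ x y) ≤ lempert D x y),
    ENNReal.ofReal (ρ z w)

/-- The quasi-hyperbolic distance of `D`: the infimum over all rectifiable curves in `D` from `z`
to `w`, parametrized by arc length as `γ : [0, L] → D`, of the arc length integral of the
reciprocal of the distance to the boundary, `∫₀ᴸ dt / dist (γ t, ∂D)`. -/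
def quasiHyperbolic {n : ℕ} (D : Set (EuclideanSpace ℂ (Fin n)))
    (z w : EuclideanSpace ℂ (Fin n)) : ℝ≥0∞ :=
  ⨅ (L : ℝ) (γ : ℝ → EuclideanSpace ℂ (Fin n))
    (_ : 0 ≤ L ∧ HasUnitSpeedOn γ (Icc 0 L) ∧ MapsTo γ (Icc 0 L) D ∧ γ 0 = z ∧ γ L = w),
    ∫⁻ t in Icc 0 L, (Metric.infEDist (γ t) (frontier D))⁻¹

end

section Kobayashi

variable {n : ℕ} {D : Set (EuclideanSpace ℂ (Fin n))}

lemma lempert_le_of_disc {z w : EuclideanSpace ℂ (Fin n)} (φ : ℂ → EuclideanSpace ℂ (Fin n)) (α : ℂ)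
    (hφ : DifferentiableOn ℂ φ (Metric.ball 0 1)) (hm : MapsTo φ (Metric.ball 0 1) D)
    (hα : ‖α‖ < 1) (h0 : φ 0 = z) (hw : φ α = w) :
    lempert D z w ≤ ENNReal.ofReal (Real.artanh ‖α‖) :=
  iInf_le_of_le φ <| iInf_le_of_le α <|
    iInf_le_of_le ⟨hφ, hm, by simpa using hα, h0, hw⟩ le_rfl

lemma kobayashi_le_lempert {z w : EuclideanSpace ℂ (Fin n)} (hz : z ∈ D) (hw : w ∈ D) :
    kobayashi D z w ≤ lempert D z w :=
  iSup₂_le fun _ h => h.2 z hz w hw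

lemma kobayashi_comm {z w : EuclideanSpace ℂ (Fin n)} (hz : z ∈ D) (hw : w ∈ D) :
    kobayashi D z w = kobayashi D w z :=
  iSup_congr fun _ => iSup_congr fun h => by rw [h.1.symm z hz w hw]

lemma kobayashi_triangle {z y w : EuclideanSpace ℂ (Fin n)} (hz : z ∈ D) (hy : y ∈ D)
    (hw : w ∈ D) : kobayashi D z w ≤ kobayashi D z y + kobayashi D y w := by
  refine iSup₂_le fun ρ h => ?_
  calc ENNReal.ofReal (ρ z w) ≤ ENNReal.ofReal (ρ z y + ρ y w) :=
        ENNReal.ofReal_le_ofReal (h.1.triangle z hz y hy w hw)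
    _ ≤ ENNReal.ofReal (ρ z y) + ENNReal.ofReal (ρ y w) := ENNReal.ofReal_add_le
    _ ≤ _ := add_le_add (le_iSup₂_of_le ρ h le_rfl) (le_iSup₂_of_le ρ h le_rfl)

lemma kobayashi_self {z : EuclideanSpace ℂ (Fin n)} (hz : z ∈ D) : kobayashi D z z = 0 :=
  le_antisymm (iSup₂_le fun ρ h => by simp [h.1.refl z hz]) zero_le

lemma Real.artanh_le_div_one_sub {x : ℝ} (h0 : 0 ≤ x) (h1 : x < 1) :
    Real.artanh x ≤ x / (1 - x) := by
  rw [Real.artanh_eq_half_log ⟨by linarith, h1.le⟩]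
  have h : 0 < 1 - x := by linarith
  have := Real.log_le_sub_one_of_pos (div_pos (by linarith : 0 < 1 + x) h)
  have e : (1 + x) / (1 - x) - 1 = 2 * (x / (1 - x)) := by field_simp; ring
  linarith

/-- The disc automorphism of radius `σ` moving the origin to `b`. -/
lemma norm_disc_automorphism_lt {σ : ℝ} {b l : ℂ} (hb : ‖b‖ < σ) (hl : ‖l‖ < 1) :
    (σ : ℂ) + starRingEnd ℂ b * l ≠ 0 ∧
      ‖(σ : ℂ) * (σ * l + b) / (σ + starRingEnd ℂ b * l)‖ < σ := by
  have hσ : 0 < σ := (norm_nonneg b).trans_lt hb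
  have hne : (σ : ℂ) + starRingEnd ℂ b * l ≠ 0 := by
    intro h
    have h2 : ‖starRingEnd ℂ b * l‖ = σ := by
      rw [eq_neg_of_add_eq_zero_right h, norm_neg, Complex.norm_real, Real.norm_of_nonneg hσ.le]
    rw [norm_mul, RCLike.norm_conj] at h2
    nlinarith [norm_nonneg b, norm_nonneg l]
  refine ⟨hne, ?_⟩
  have key : ‖(σ : ℂ) * l + b‖ < ‖(σ : ℂ) + starRingEnd ℂ b * l‖ := by
    refine lt_of_pow_lt_pow_left₀ 2 (norm_nonneg _) ?_
    have e : ‖(σ : ℂ) + starRingEnd ℂ b * l‖ ^ 2 - ‖(σ : ℂ) * l + b‖ ^ 2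
        = (σ ^ 2 - ‖b‖ ^ 2) * (1 - ‖l‖ ^ 2) := by
      simp only [Complex.sq_norm, Complex.normSq_apply, Complex.add_re, Complex.add_im,
        Complex.mul_re, Complex.mul_im, Complex.ofReal_re, Complex.ofReal_im, Complex.conj_re,
        Complex.conj_im]
      ring
    have h1 : 0 < σ ^ 2 - ‖b‖ ^ 2 := by nlinarith [norm_nonneg b]
    have h2 : 0 < 1 - ‖l‖ ^ 2 := by nlinarith [norm_nonneg l]
    nlinarith [mul_pos h1 h2]
  rw [norm_div, norm_mul, Complex.norm_real, Real.norm_of_nonneg hσ.le,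
    div_lt_iff₀ (norm_pos_iff.2 hne)]
  exact mul_lt_mul_of_pos_left key hσ

lemma norm_add_smul_sub_sq {z c u : EuclideanSpace ℂ (Fin n)} (hu : ‖u‖ = 1) (ζ : ℂ) :
    ‖z + ζ • u - c‖ ^ 2 = ‖z - c‖ ^ 2 - ‖inner ℂ u (z - c)‖ ^ 2 + ‖ζ + inner ℂ u (z - c)‖ ^ 2 := by
  have e : z + ζ • u - c = ζ • u + (z - c) := by abel
  rw [e, @norm_add_sq ℂ, norm_smul, hu, inner_smul_left]
  generalize inner ℂ u (z - c) = b
  simp only [Complex.sq_norm, Complex.normSq_apply, Complex.add_re, Complex.add_im, RCLike.re_to_complex,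
        Complex.mul_re, Complex.conj_re, Complex.conj_im, mul_one]
  ring

/-- The Lempert function of a set containing a ball, estimated through the disc which the ball cuts
out of the complex line joining the two points. -/
lemma lempert_le_of_ball_subset {c z w : EuclideanSpace ℂ (Fin n)} {ρ : ℝ}
    (hball : Metric.ball c ρ ⊆ D) (hρ : 0 < ρ)
    (h : 2 * ρ * ‖z - w‖ < ρ ^ 2 - ‖z - c‖ ^ 2) :
    lempert D z w ≤
      ENNReal.ofReal (ρ * ‖z - w‖ / (ρ ^ 2 - ‖z - c‖ ^ 2 - 2 * ρ * ‖z - w‖)) := by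
  rcases eq_or_ne z w with rfl | hzw
  · have hz : ‖z - c‖ < ρ := by
      simp only [sub_self, norm_zero, mul_zero] at h
      exact lt_of_pow_lt_pow_left₀ 2 hρ.le (by linarith)
    refine (lempert_le_of_disc (fun _ => z) 0 (differentiableOn_const z)
      (fun _ _ => hball (by rwa [mem_ball_iff_norm])) (by simp) rfl rfl).trans (by simp)
  set t := ‖z - w‖ with ht
  have ht0 : 0 < t := norm_pos_iff.2 (sub_ne_zero.2 hzw)
  obtain ⟨u, hu, hwu⟩ : ∃ u : EuclideanSpace ℂ (Fin n), ‖u‖ = 1 ∧ w = z + (t : ℂ) • u := by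
    have htc : (t : ℂ) ≠ 0 := by exact_mod_cast ht0.ne'
    refine ⟨(t : ℂ)⁻¹ • (w - z), ?_, ?_⟩
    · rw [norm_smul, norm_inv, Complex.norm_real, Real.norm_of_nonneg ht0.le, norm_sub_rev, ← ht,
        inv_mul_cancel₀ ht0.ne']
    · rw [smul_inv_smul₀ htc]; abel
  set b : ℂ := inner ℂ u (z - c) with hb
  set A := ρ ^ 2 - ‖z - c‖ ^ 2 with hA
  have hA0 : 0 < A := lt_trans (by positivity) h
  have hbz : ‖b‖ ≤ ‖z - c‖ := by
    simpa [hu] using norm_inner_le_norm (𝕜 := ℂ) u (z - c)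
  set σ := √(A + ‖b‖ ^ 2) with hσ
  have hσ2 : σ ^ 2 = A + ‖b‖ ^ 2 := Real.sq_sqrt (by positivity)
  have hσ0 : 0 ≤ σ := Real.sqrt_nonneg _
  have hbσ : ‖b‖ < σ := lt_of_pow_lt_pow_left₀ 2 hσ0 (by linarith)
  have hσρ : σ ≤ ρ := by
    refine le_of_sq_le_sq ?_ hρ.le
    have := pow_le_pow_left₀ (norm_nonneg b) hbz 2
    rw [hσ2]; linarith
  have hσpos : 0 < σ := (norm_nonneg b).trans_lt hbσ
  have hσc : (σ : ℂ) ≠ 0 := by exact_mod_cast hσpos.ne'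
  set q : ℂ := A - starRingEnd ℂ b * t with hq
  have hqn : A - ρ * t ≤ ‖q‖ := by
    have h1 : ‖(A : ℂ)‖ - ‖starRingEnd ℂ b * t‖ ≤ ‖q‖ := norm_sub_norm_le _ _
    rw [norm_mul, RCLike.norm_conj, Complex.norm_real, Complex.norm_real,
      Real.norm_of_nonneg hA0.le, Real.norm_of_nonneg ht0.le] at h1
    nlinarith
  have hApos : 0 < A - ρ * t := by nlinarith
  have hq0 : q ≠ 0 := norm_pos_iff.1 (hApos.trans_le hqn)
  have hαn : ‖(σ : ℂ) * t / q‖ ≤ ρ * t / (A - ρ * t) := by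
    rw [norm_div, norm_mul, Complex.norm_real, Complex.norm_real, Real.norm_of_nonneg ht0.le,
      Real.norm_of_nonneg hσ0]
    gcongr
  have hx1 : ρ * t / (A - ρ * t) < 1 := by rw [div_lt_one hApos]; linarith
  have hbb : starRingEnd ℂ b * b = (σ : ℂ) ^ 2 - A := by
    rw [← Complex.normSq_eq_conj_mul_self, Complex.normSq_eq_norm_sq]
    have : ‖b‖ ^ 2 = σ ^ 2 - A := by linarith
    rw [this]; push_cast; ring
  refine (lempert_le_of_disc
    (fun l => z + ((σ : ℂ) * (σ * l + b) / (σ + starRingEnd ℂ b * l) - b) • u)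
    ((σ : ℂ) * t / q) ?_ ?_ (hαn.trans_lt hx1) ?_ ?_).trans ?_
  · refine (differentiableOn_const z).add (DifferentiableOn.smul_const (DifferentiableOn.sub_const ?_ b) u)
    refine DifferentiableOn.div (by fun_prop) (by fun_prop) fun l hl => ?_
    exact (norm_disc_automorphism_lt hbσ (by simpa using hl)).1
  · intro l hl
    have hl' := (norm_disc_automorphism_lt hbσ (by simpa using hl : ‖l‖ < 1)).2
    refine hball ?_
    rw [mem_ball_iff_norm]
    refine lt_of_pow_lt_pow_left₀ 2 hρ.le ?_
    rw [norm_add_smul_sub_sq hu, ← hb, sub_add_cancel]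
    have := pow_lt_pow_left₀ hl' (norm_nonneg _) two_ne_zero
    linarith
  · simp [hσc]
  · have hne := (norm_disc_automorphism_lt hbσ (hαn.trans_lt hx1)).1
    have : (σ : ℂ) * (σ * ((σ : ℂ) * t / q) + b) / (σ + starRingEnd ℂ b * ((σ : ℂ) * t / q)) - b
        = t := by
      rw [sub_eq_iff_eq_add, div_eq_iff hne]
      field_simp
      rw [hq]
      linear_combination -(t : ℂ) * hbb
    simp only [this, hwu]
  · refine ENNReal.ofReal_le_ofReal ?_
    refine (Real.artanh_le_artanh (by linarith [norm_nonneg ((σ : ℂ) * t / q)]) hx1 hαn).trans ?_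
    refine (Real.artanh_le_div_one_sub (by positivity) hx1).trans (le_of_eq ?_)
    have e : 1 - ρ * t / (A - ρ * t) = (A - 2 * ρ * t) / (A - ρ * t) := by
      rw [eq_div_iff hApos.ne', sub_mul, div_mul_cancel₀ _ hApos.ne']; ring
    rw [e, div_div_div_cancel_right₀ hApos.ne']

end Kobayashi

section InteriorBalls

variable {n : ℕ} {D : Set (EuclideanSpace ℂ (Fin n))}

lemma infDist_frontier_pos {z : EuclideanSpace ℂ (Fin n)} (hD : IsOpen D)
    (hne : (frontier D).Nonempty) (hz : z ∈ D) : 0 < Metric.infDist z (frontier D) :=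
  (isClosed_frontier.notMem_iff_infDist_pos hne).1
    fun h => (disjoint_frontier_iff_isOpen.2 hD).le_bot ⟨h, hz⟩

lemma ball_infDist_frontier_subset {z : EuclideanSpace ℂ (Fin n)} (hD : IsOpen D) (hz : z ∈ D) :
    Metric.ball z (Metric.infDist z (frontier D)) ⊆ D := by
  rcases le_or_gt (Metric.infDist z (frontier D)) 0 with h0 | h0
  · simp [Metric.ball_eq_empty.2 h0]
  refine IsPreconnected.subset_left_of_subset_union hD isClosed_closure.isOpen_compl
    (disjoint_compl_right.mono_left subset_closure) (fun x hx => ?_)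
    ⟨z, Metric.mem_ball_self h0, hz⟩ (convex_ball z _).isPreconnected
  by_contra hx'
  simp only [mem_union, mem_compl_iff, not_or, not_not] at hx'
  refine Metric.disjoint_ball_infDist.le_bot ⟨hx, ?_⟩
  rw [hD.frontier_eq]
  exact ⟨hx'.2, hx'.1⟩

lemma le_infDist_frontier_of_ball_subset {z : EuclideanSpace ℂ (Fin n)} {ρ : ℝ} (hD : IsOpen D)
    (hne : (frontier D).Nonempty) (h : Metric.ball z ρ ⊆ D) :
    ρ ≤ Metric.infDist z (frontier D) := by
  refine (Metric.le_infDist hne).2 fun y hy => ?_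
  by_contra! hlt
  exact (disjoint_frontier_iff_isOpen.2 hD).le_bot
    ⟨hy, h (by rwa [Metric.mem_ball, dist_comm])⟩

/-- Near a `C¹`-smooth boundary point `a` there is one direction `ν` along which every point of
`D` ascends inside `D` with almost unit speed away from the boundary. -/
lemma IsC1BoundaryPoint.exists_ball_subset {a : EuclideanSpace ℂ (Fin n)} (hD : IsOpen D)
    (ha : IsC1BoundaryPoint D a) {θ : ℝ} (h0 : 0 < θ) (h1 : θ < 1) :
    ∃ (ν : EuclideanSpace ℂ (Fin n)) (R : ℝ), ‖ν‖ ≤ 1 ∧ 0 < R ∧ ∀ z ∈ D, ‖z - a‖ < R →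
      ∀ t, 0 ≤ t → t ≤ R →
        Metric.ball (z + t • ν) (θ * (Metric.infDist z (frontier D) + t)) ⊆ D := by
  obtain ⟨haf, U, r, hU, haU, hr, hL0, hDU⟩ := ha
  have hstrict : HasStrictFDerivAt r (fderiv ℝ r a) a :=
    (hr.contDiffAt (hU.mem_nhds haU)).hasStrictFDerivAt one_ne_zero
  set l := fderiv ℝ r a with hl
  have hlpos : 0 < ‖l‖ := norm_pos_iff.2 hL0
  set ε := (1 - θ) / 4 with hε
  have hε0 : 0 < ε := by rw [hε]; linarith
  obtain ⟨ν, hν1, hνl⟩ : ∃ ν : EuclideanSpace ℂ (Fin n), ‖ν‖ ≤ 1 ∧ l ν ≤ -((1 - ε) * ‖l‖) := by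
    obtain ⟨x, hx1, hx⟩ := l.exists_lt_apply_of_lt_opNorm
      (show (1 - ε) * ‖l‖ < ‖l‖ by nlinarith)
    rcases abs_cases (l x) with ⟨hc, _⟩ | ⟨hc, _⟩ <;> rw [Real.norm_eq_abs, hc] at hx
    · exact ⟨-x, by rw [norm_neg]; exact hx1.le, by rw [map_neg]; linarith⟩
    · exact ⟨x, hx1.le, by linarith⟩
  obtain ⟨s, hs, happ⟩ := hstrict.approximates_deriv_on_nhds
    (c := (ε * ‖l‖).toNNReal) (Or.inr (Real.toNNReal_pos.2 (mul_pos hε0 hlpos)))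
  obtain ⟨R₀, hR₀, hball⟩ := Metric.mem_nhds_iff.1 (inter_mem hs (hU.mem_nhds haU))
  refine ⟨ν, R₀ / 5, hν1, by positivity, fun z hz hza t ht htR y hy => ?_⟩
  set d := Metric.infDist z (frontier D) with hd
  have hd0 : 0 < d := infDist_frontier_pos hD ⟨a, haf⟩ hz
  have hda : d ≤ ‖z - a‖ := by
    rw [← dist_eq_norm]; exact Metric.infDist_le_dist_of_mem haf
  obtain ⟨v, hv, rfl⟩ : ∃ v, ‖v‖ < θ * (d + t) ∧ y = z + t • ν + v :=
    ⟨y - (z + t • ν), by rwa [mem_ball_iff_norm] at hy, by abel⟩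
  set x := z - ((1 - ε) * d) • ν with hx
  have hε1 : ε < 1 := by rw [hε]; linarith
  have hsm : ∀ c : ℝ, 0 ≤ c → ‖c • ν‖ ≤ c := fun c hc => by
    rw [norm_smul, Real.norm_of_nonneg hc]; nlinarith
  have hxz : ‖x - z‖ ≤ (1 - ε) * d := by
    rw [hx, sub_sub_cancel_left, norm_neg]
    exact hsm _ (by nlinarith)
  have hxD : x ∈ D := ball_infDist_frontier_subset hD hz (by
    rw [mem_ball_iff_norm]; exact hxz.trans_lt (by nlinarith))
  have hxa : ‖x - a‖ < R₀ := by
    have := norm_sub_le_norm_sub_add_norm_sub x z a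
    nlinarith
  have hya : ‖z + t • ν + v - a‖ < R₀ := by
    have e : z + t • ν + v - a = (z - a) + t • ν + v := by abel
    have := norm_add₃_le (a := z - a) (b := t • ν) (c := v)
    rw [← e] at this
    have := hsm t ht
    nlinarith
  have hxs := hball (mem_ball_iff_norm.2 hxa)
  have hys := hball (mem_ball_iff_norm.2 hya)
  have hrx : r x < 0 := (hDU.subset ⟨hxD, hxs.2⟩).2
  have hap := happ _ hys.1 _ hxs.1
  rw [Real.coe_toNNReal _ (by positivity)] at hap
  set y := z + t • ν + v with hy'
  have e : y - x = (t + (1 - ε) * d) • ν + v := by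
    rw [hy', hx, add_smul]; abel
  have hnyx : ‖y - x‖ ≤ 2 * (d + t) := by
    rw [e]
    refine (norm_add_le _ _).trans ?_
    have := hsm (t + (1 - ε) * d) (by nlinarith)
    nlinarith
  have hlyx : l (y - x) ≤ -((1 - ε) * (1 - ε) * ‖l‖ * (d + t)) + ‖l‖ * (θ * (d + t)) := by
    rw [e, map_add, map_smul, smul_eq_mul]
    have h1 : l v ≤ ‖l‖ * (θ * (d + t)) :=
      (Real.le_norm_self _).trans ((l.le_opNorm v).trans (by gcongr))
    have h2 : (t + (1 - ε) * d) * l ν ≤ (t + (1 - ε) * d) * -((1 - ε) * ‖l‖) :=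
      mul_le_mul_of_nonneg_left hνl (by nlinarith)
    have h3 : 0 ≤ (ε * t) * ((1 - ε) * ‖l‖) := by
      have : 0 ≤ 1 - ε := by linarith
      positivity
    linarith
  have hap' : r y - r x - l (y - x) ≤ ε * ‖l‖ * (2 * (d + t)) :=
    (Real.le_norm_self _).trans (hap.trans (mul_le_mul_of_nonneg_left hnyx (by positivity)))
  have hry : r y < 0 := by
    have hk : 0 ≤ ((1 - ε) * (1 - ε) - θ - 2 * ε) * (‖l‖ * (d + t)) := by
      refine mul_nonneg ?_ (by positivity)
      have : θ = 1 - 4 * ε := by rw [hε]; ring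
      rw [this]; nlinarith
    linarith
  exact (hDU.symm.subset ⟨hys.2, hry⟩).1

/-- Local upper estimate of the Kobayashi pseudodistance near a `C¹`-smooth boundary point. -/
lemma IsC1BoundaryPoint.kobayashi_le {a : EuclideanSpace ℂ (Fin n)} (hD : IsOpen D)
    (ha : IsC1BoundaryPoint D a) {c : ℝ} (hc : 1 / 2 < c) :
    ∃ (R δ : ℝ), 0 < R ∧ 0 < δ ∧ ∀ z ∈ D, ‖z - a‖ < R → ∀ w ∈ D,
      ‖z - w‖ ≤ δ * Metric.infDist z (frontier D) →
      kobayashi D z w ≤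
        ENNReal.ofReal (c * (‖z - w‖ / (Metric.infDist z (frontier D) + ‖z - w‖))) := by
  obtain ⟨K, hK0, hK⟩ : ∃ K : ℝ, 0 < K ∧ K + 1 < c * (2 * K + 1) := by
    refine ⟨1 / (2 * c - 1), by apply one_div_pos.2; linarith, ?_⟩
    have h : 0 < 2 * c - 1 := by linarith
    have : (2 * c - 1) * (1 / (2 * c - 1)) = 1 := by field_simp
    nlinarith
  obtain ⟨δ, ⟨hδ0, hδ1⟩, hδ⟩ : ∃ δ : ℝ, (0 < δ ∧ δ < 1) ∧
      (K + 1 - δ) * (1 + δ) < c * ((K + 1 - δ) ^ 2 - K ^ 2 - 2 * (K + 1 - δ) * δ) := by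
    have hcont : Continuous fun δ : ℝ =>
        c * ((K + 1 - δ) ^ 2 - K ^ 2 - 2 * (K + 1 - δ) * δ) - (K + 1 - δ) * (1 + δ) := by
      fun_prop
    have h0 := (hcont.tendsto 0).eventually_const_lt (u := 0) (by ring_nf; linarith)
    have h2 : ∀ᶠ δ : ℝ in 𝓝[>] 0, 0 < δ ∧ δ < 1 :=
      Ioo_mem_nhdsGT (zero_lt_one : (0 : ℝ) < 1)
    obtain ⟨δ, h3, h4⟩ := ((h0.filter_mono nhdsWithin_le_nhds).and h2).exists
    exact ⟨δ, h4, by linarith⟩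
  obtain ⟨ν, R, hν, hR, hball⟩ := ha.exists_ball_subset hD (θ := (K + 1 - δ) / (K + 1))
    (div_pos (by linarith) (by linarith)) ((div_lt_one (by linarith)).2 (by linarith))
  refine ⟨min R (R / K), δ, by positivity, hδ0, fun z hz hza w hw hzw => ?_⟩
  refine (kobayashi_le_lempert hz hw).trans ?_
  set d := Metric.infDist z (frontier D) with hd
  have hd0 : 0 < d := infDist_frontier_pos hD ⟨a, ha.1⟩ hz
  have hda : d ≤ ‖z - a‖ := by
    rw [← dist_eq_norm]; exact Metric.infDist_le_dist_of_mem ha.1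
  have hKd : K * d ≤ R := by
    have := (hda.trans_lt hza).le.trans (min_le_right _ _)
    rw [le_div_iff₀ hK0] at this; linarith
  have hb := hball z hz (hza.trans_le (min_le_left _ _)) (K * d) (by positivity) hKd
  set q := K + 1 - δ with hq
  have hq0 : 0 < q := by rw [hq]; linarith
  have hrad : q / (K + 1) * (d + K * d) = q * d := by field_simp; ring
  rw [hrad] at hb
  have hzc : ‖z - (z + (K * d) • ν)‖ ≤ K * d := by
    rw [sub_add_cancel_left, norm_neg, norm_smul, Real.norm_of_nonneg (by positivity)]
    exact mul_le_of_le_one_right (by positivity) hν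
  set t := ‖z - w‖ with ht
  have ht0 : 0 ≤ t := norm_nonneg _
  have hA : (q ^ 2 - K ^ 2) * d ^ 2 ≤ (q * d) ^ 2 - ‖z - (z + (K * d) • ν)‖ ^ 2 := by
    have := pow_le_pow_left₀ (norm_nonneg _) hzc 2
    nlinarith
  set A := (q * d) ^ 2 - ‖z - (z + (K * d) • ν)‖ ^ 2
  have hB : 0 < q ^ 2 - K ^ 2 - 2 * q * δ := by
    have : 0 < q * (1 + δ) := by positivity
    exact pos_of_mul_pos_right (this.trans hδ) (by linarith)
  have hBA : (q ^ 2 - K ^ 2 - 2 * q * δ) * d ^ 2 ≤ A - 2 * (q * d) * t := by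
    have : 2 * (q * d) * t ≤ 2 * (q * d) * (δ * d) := by gcongr
    linarith
  have hApos : 0 < A - 2 * (q * d) * t := lt_of_lt_of_le (by positivity) hBA
  refine (lempert_le_of_ball_subset hb (by positivity) (by linarith)).trans
    (ENNReal.ofReal_le_ofReal ?_)
  rw [← mul_div_assoc, div_le_div_iff₀ hApos (by positivity)]
  have h1 : q * d * (d + t) ≤ c * (A - 2 * (q * d) * t) := by
    calc q * d * (d + t) ≤ q * d * (d + δ * d) := by gcongr
      _ = q * (1 + δ) * d ^ 2 := by ring
      _ ≤ c * (q ^ 2 - K ^ 2 - 2 * q * δ) * d ^ 2 := by gcongr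
      _ ≤ c * (A - 2 * (q * d) * t) := by rw [mul_assoc]; gcongr
  calc q * d * t * (d + t) = t * (q * d * (d + t)) := by ring
    _ ≤ t * (c * (A - 2 * (q * d) * t)) := by gcongr
    _ = _ := by ring

end InteriorBalls

section Curves

variable {n : ℕ} {D : Set (EuclideanSpace ℂ (Fin n))}

lemma ofReal_inv_le_inv_infEDist {X : Type*} [PseudoMetricSpace X] {x : X} {s : Set X} {m : ℝ}
    (hs : s.Nonempty) (hm : 0 < m) (h : Metric.infDist x s ≤ m) :
    ENNReal.ofReal m⁻¹ ≤ (Metric.infEDist x s)⁻¹ := by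
  rw [ENNReal.ofReal_inv_of_pos hm, ENNReal.inv_le_inv]
  rw [← ENNReal.ofReal_toReal (Metric.infEDist_ne_top hs)]
  exact ENNReal.ofReal_le_ofReal h

lemma inv_infEDist_le_ofReal_inv {X : Type*} [PseudoMetricSpace X] {x : X} {s : Set X} {m : ℝ}
    (hs : s.Nonempty) (hm : 0 < m) (h : m ≤ Metric.infDist x s) :
    (Metric.infEDist x s)⁻¹ ≤ ENNReal.ofReal m⁻¹ := by
  rw [ENNReal.ofReal_inv_of_pos hm, ENNReal.inv_le_inv]
  rw [← ENNReal.ofReal_toReal (Metric.infEDist_ne_top hs)]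
  exact ENNReal.ofReal_le_ofReal h

lemma lintegral_Ioc_ofReal_eq_sub {f f' : ℝ → ℝ} {a b : ℝ} (hab : a ≤ b)
    (hf : ∀ t ∈ Icc a b, HasDerivAt f (f' t) t) (hc : ContinuousOn f' (Icc a b))
    (h0 : ∀ t ∈ Icc a b, 0 ≤ f' t) :
    ∫⁻ t in Ioc a b, ENNReal.ofReal (f' t) = ENNReal.ofReal (f b - f a) := by
  have hi : IntervalIntegrable f' MeasureTheory.volume a b :=
    ContinuousOn.intervalIntegrable (by rwa [uIcc_of_le hab])
  rw [← intervalIntegral.integral_eq_sub_of_hasDerivAt (by rwa [uIcc_of_le hab]) hi,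
    intervalIntegral.integral_of_le hab,
    MeasureTheory.ofReal_integral_eq_lintegral_ofReal hi.1]
  filter_upwards [MeasureTheory.ae_restrict_mem measurableSet_Ioc] with t ht
  exact h0 t ⟨ht.1.le, ht.2⟩

lemma lintegral_Ioc_inv_add_sub_left {a b d : ℝ} (hab : a ≤ b) (hd : 0 < d) :
    ∫⁻ t in Ioc a b, ENNReal.ofReal (d + (t - a))⁻¹ =
      ENNReal.ofReal (Real.log (d + (b - a)) - Real.log d) := by
  have hpos : ∀ t ∈ Icc a b, 0 < d + (t - a) := fun t ht => by linarith [ht.1]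
  rw [lintegral_Ioc_ofReal_eq_sub (f := fun t => Real.log (d + (t - a))) hab]
  · simp
  · intro t ht
    simpa using (((hasDerivAt_id t).sub_const a).const_add d).log (hpos t ht).ne'
  · exact ContinuousOn.inv₀ (by fun_prop) fun t ht => (hpos t ht).ne'
  · exact fun t ht => inv_nonneg.2 (hpos t ht).le

lemma lintegral_Ioc_inv_add_sub_right {a b d : ℝ} (hab : a ≤ b) (hd : 0 < d) :
    ∫⁻ t in Ioc a b, ENNReal.ofReal (d + (b - t))⁻¹ =
      ENNReal.ofReal (Real.log (d + (b - a)) - Real.log d) := by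
  have hpos : ∀ t ∈ Icc a b, 0 < d + (b - t) := fun t ht => by linarith [ht.2]
  rw [lintegral_Ioc_ofReal_eq_sub (f := fun t => -Real.log (d + (b - t))) hab]
  · simp [neg_add_eq_sub]
  · intro t ht
    simpa [neg_div] using ((((hasDerivAt_id t).const_sub b).const_add d).log (hpos t ht).ne').fun_neg
  · exact ContinuousOn.inv₀ (by fun_prop) fun t ht => (hpos t ht).ne'
  · exact fun t ht => inv_nonneg.2 (hpos t ht).le

lemma HasUnitSpeedOn.dist_le {X : Type*} [PseudoMetricSpace X] {γ : ℝ → X} {s : Set ℝ}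
    (h : HasUnitSpeedOn γ s) {x y : ℝ} (hx : x ∈ s) (hy : y ∈ s) (hxy : x ≤ y) :
    dist (γ x) (γ y) ≤ y - x := by
  have h1 := h hx hy
  rw [NNReal.coe_one, one_mul] at h1
  have h2 := eVariationOn.edist_le γ (s := s ∩ Icc x y) ⟨hx, left_mem_Icc.2 hxy⟩
    ⟨hy, right_mem_Icc.2 hxy⟩
  rw [h1] at h2
  exact (edist_le_ofReal (by linarith)).1 h2

/-- A local bound of the Kobayashi pseudodistance by `c |dz| / d` integrates along
curves. -/
lemma kobayashi_le_lintegral (hD : IsOpen D) (hne : (frontier D).Nonempty)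
    {G : Set (EuclideanSpace ℂ (Fin n))} {c δ : ℝ} (hc : 0 ≤ c) (hδ : 0 < δ) (hGD : G ⊆ D)
    (hloc : ∀ z ∈ G, ∀ w ∈ D, ‖z - w‖ ≤ δ * Metric.infDist z (frontier D) →
      kobayashi D z w ≤
        ENNReal.ofReal (c * (‖z - w‖ / (Metric.infDist z (frontier D) + ‖z - w‖))))
    {γ : ℝ → EuclideanSpace ℂ (Fin n)} {L : ℝ} (hL : 0 ≤ L)
    (hγ : ∀ s ∈ Icc 0 L, ∀ t ∈ Icc 0 L, s ≤ t → dist (γ s) (γ t) ≤ t - s)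
    (hG : MapsTo γ (Icc 0 L) G) :
    kobayashi D (γ 0) (γ L) ≤
      ENNReal.ofReal c * ∫⁻ t in Ioc 0 L, (Metric.infEDist (γ t) (frontier D))⁻¹ := by
  have hcont : ContinuousOn γ (Icc 0 L) := by
    refine LipschitzOnWith.continuousOn (K := 1) (LipschitzOnWith.of_dist_le_mul fun s hs t ht => ?_)
    rw [NNReal.coe_one, one_mul, Real.dist_eq]
    rcases le_total s t with h | h
    · rw [abs_sub_comm, abs_of_nonneg (sub_nonneg.2 h)]; exact hγ s hs t ht h
    · rw [abs_of_nonneg (sub_nonneg.2 h), dist_comm]; exact hγ t ht s hs h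
  obtain ⟨m, hm, hmd⟩ : ∃ m, 0 < m ∧ ∀ t ∈ Icc 0 L, m ≤ Metric.infDist (γ t) (frontier D) := by
    obtain ⟨t₀, ht₀, hmin⟩ := isCompact_Icc.exists_isMinOn (nonempty_Icc.2 hL)
      ((Metric.continuous_infDist_pt (frontier D)).comp_continuousOn hcont)
    exact ⟨_, infDist_frontier_pos hD hne (hGD (hG ht₀)), hmin⟩
  have step : ∀ a b, a ∈ Icc 0 L → b ∈ Icc 0 L → a ≤ b → b - a ≤ δ * m →
      kobayashi D (γ a) (γ b) ≤
        ENNReal.ofReal c * ∫⁻ t in Ioc a b, (Metric.infEDist (γ t) (frontier D))⁻¹ := by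
    intro a b ha hb hab hs
    set d := Metric.infDist (γ a) (frontier D) with hd
    have hd0 : 0 < d := hm.trans_le (hmd a ha)
    have hab' : ‖γ a - γ b‖ ≤ b - a := by rw [← dist_eq_norm]; exact hγ a ha b hb hab
    have h1 : ENNReal.ofReal ((d + (b - a))⁻¹ * (b - a)) ≤
        ∫⁻ t in Ioc a b, (Metric.infEDist (γ t) (frontier D))⁻¹ := by
      have hpos : 0 < d + (b - a) := by linarith
      rw [ENNReal.ofReal_mul (inv_nonneg.2 hpos.le), ← Real.volume_Ioc,
        ← MeasureTheory.setLIntegral_const]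
      refine MeasureTheory.setLIntegral_mono' measurableSet_Ioc fun t ht => ?_
      refine ofReal_inv_le_inv_infEDist hne hpos ?_
      have ht' : t ∈ Icc 0 L := ⟨ha.1.trans ht.1.le, ht.2.trans hb.2⟩
      have := Metric.infDist_le_infDist_add_dist (s := frontier D) (x := γ t) (y := γ a)
      have := hγ a ha t ht' ht.1.le
      rw [dist_comm] at this
      linarith [ht.2]
    refine (hloc _ (hG ha) _ (hGD (hG hb)) ?_).trans ?_
    · exact hab'.trans (hs.trans (by gcongr; exact hmd a ha))
    · rw [ENNReal.ofReal_mul hc]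
      gcongr
      refine (ENNReal.ofReal_le_ofReal ?_).trans h1
      rw [inv_mul_eq_div, div_le_div_iff₀ (by positivity) (by linarith)]
      nlinarith
  obtain ⟨N, hN⟩ := exists_nat_gt (L / (δ * m))
  have hδm : 0 < δ * m := by positivity
  have hN0 : 0 < (N : ℝ) := lt_of_le_of_lt (by positivity) hN
  set h := L / N with hh
  have hh0 : 0 ≤ h := by positivity
  have hhs : h ≤ δ * m := by
    rw [hh, div_le_iff₀ hN0]
    rw [div_lt_iff₀ hδm] at hN
    linarith
  have hNh : N * h = L := by rw [hh]; field_simp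
  have hmem : ∀ i : ℕ, i ≤ N → (i : ℝ) * h ∈ Icc 0 L := fun i hi =>
    ⟨by positivity, by rw [← hNh]; gcongr⟩
  have ind : ∀ i : ℕ, i ≤ N → kobayashi D (γ 0) (γ (i * h)) ≤
      ENNReal.ofReal c * ∫⁻ t in Ioc 0 (i * h), (Metric.infEDist (γ t) (frontier D))⁻¹ := by
    intro i
    induction i with
    | zero =>
      intro _
      have := hGD (hG (left_mem_Icc.2 hL))
      simp [kobayashi_self this]
    | succ i ih =>
      intro hi
      have hi' : i ≤ N := by omega
      have hle : (i : ℝ) * h ≤ ((i + 1 : ℕ) : ℝ) * h := by gcongr; simp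
      have hmi := hmem i hi'
      have hmi1 := hmem (i + 1) hi
      rw [← Ioc_union_Ioc_eq_Ioc hmi.1 hle,
        MeasureTheory.lintegral_union measurableSet_Ioc (Ioc_disjoint_Ioc_of_le le_rfl), mul_add]
      refine (kobayashi_triangle (hGD (hG (left_mem_Icc.2 hL))) (hGD (hG hmi))
        (hGD (hG hmi1))).trans (add_le_add (ih hi') (step _ _ hmi hmi1 hle ?_))
      push_cast
      linarith
  have := ind N le_rfl
  rwa [hNh] at this

/-- A curve of length `L` through points at distance `d` and `d'` from the boundary, split at
time `s`. -/
lemma ofReal_log_add_le_lintegral (hD : IsOpen D) (hne : (frontier D).Nonempty)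
    {γ : ℝ → EuclideanSpace ℂ (Fin n)} {L s : ℝ} (hs : s ∈ Icc 0 L)
    (hγ : ∀ s ∈ Icc 0 L, ∀ t ∈ Icc 0 L, s ≤ t → dist (γ s) (γ t) ≤ t - s)
    (h0 : γ 0 ∈ D) (hL : γ L ∈ D) :
    ENNReal.ofReal (Real.log (Metric.infDist (γ 0) (frontier D) + s)
        - Real.log (Metric.infDist (γ 0) (frontier D))) +
      ENNReal.ofReal (Real.log (Metric.infDist (γ L) (frontier D) + (L - s))
        - Real.log (Metric.infDist (γ L) (frontier D))) ≤
      ∫⁻ t in Icc 0 L, (Metric.infEDist (γ t) (frontier D))⁻¹ := by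
  have hL0 : 0 ≤ L := hs.1.trans hs.2
  have hp0 := infDist_frontier_pos hD hne h0
  have hpL := infDist_frontier_pos hD hne hL
  have e1 := lintegral_Ioc_inv_add_sub_left hs.1 hp0
  rw [sub_zero] at e1
  rw [← e1, ← lintegral_Ioc_inv_add_sub_right hs.2 hpL]
  refine le_trans (add_le_add (b := ∫⁻ t in Ioc 0 s, (Metric.infEDist (γ t) (frontier D))⁻¹)
    (d := ∫⁻ t in Ioc s L, (Metric.infEDist (γ t) (frontier D))⁻¹) ?_ ?_) ?_
  · refine MeasureTheory.setLIntegral_mono' measurableSet_Ioc fun t ht => ?_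
    refine ofReal_inv_le_inv_infEDist hne (by linarith [ht.1]) ?_
    have := Metric.infDist_le_infDist_add_dist (s := frontier D) (x := γ t) (y := γ 0)
    have := hγ 0 ⟨le_rfl, hL0⟩ t ⟨ht.1.le, ht.2.trans hs.2⟩ ht.1.le
    rw [dist_comm] at this
    linarith
  · refine MeasureTheory.setLIntegral_mono' measurableSet_Ioc fun t ht => ?_
    refine ofReal_inv_le_inv_infEDist hne (by linarith [ht.2]) ?_
    have := Metric.infDist_le_infDist_add_dist (s := frontier D) (x := γ t) (y := γ L)
    have := hγ t ⟨hs.1.trans ht.1.le, ht.2⟩ L ⟨hL0, le_rfl⟩ ht.2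
    linarith
  · rw [← MeasureTheory.lintegral_union measurableSet_Ioc (Ioc_disjoint_Ioc_of_le le_rfl),
      Ioc_union_Ioc_eq_Ioc hs.1 hs.2]
    exact MeasureTheory.lintegral_mono_set Ioc_subset_Icc_self

end Curves

section Finiteness

variable {n : ℕ} {D : Set (EuclideanSpace ℂ (Fin n))}

lemma eventually_kobayashi_le_one (hD : IsOpen D) {x : EuclideanSpace ℂ (Fin n)} (hx : x ∈ D) :
    ∀ᶠ y in 𝓝 x, y ∈ D ∧ kobayashi D x y ≤ 1 := by
  obtain ⟨ρ, hρ, hball⟩ := Metric.isOpen_iff.1 hD x hx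
  filter_upwards [Metric.ball_mem_nhds x (show 0 < ρ / 4 by positivity)] with y hy
  rw [mem_ball_iff_norm, norm_sub_rev] at hy
  have hyD : y ∈ D := hball (by
    rw [mem_ball_iff_norm, norm_sub_rev]; linarith)
  refine ⟨hyD, (kobayashi_le_lempert hx hyD).trans
    ((lempert_le_of_ball_subset hball hρ ?_).trans ?_)⟩
  · rw [sub_self, norm_zero]; nlinarith
  · rw [sub_self, norm_zero, ENNReal.ofReal_le_one, div_le_one (by nlinarith)]
    nlinarith

lemma kobayashi_lt_top (hD : IsOpen D) (hconn : IsConnected D) {x y : EuclideanSpace ℂ (Fin n)}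
    (hx : x ∈ D) (hy : y ∈ D) : kobayashi D x y < ⊤ := by
  refine hconn.isPreconnected.induction₂' (fun x y => kobayashi D x y < ⊤) (fun x hx => ?_)
    (fun x y z hx hy hz h1 h2 => ?_) hx hy
  · filter_upwards [nhdsWithin_le_nhds (eventually_kobayashi_le_one hD hx)] with y hy
    have : kobayashi D x y < ⊤ := hy.2.trans_lt ENNReal.one_lt_top
    exact ⟨this, by rwa [kobayashi_comm hy.1 hx]⟩
  · exact (kobayashi_triangle hx hy hz).trans_lt (ENNReal.add_lt_top.2 ⟨h1, h2⟩)

lemma exists_kobayashi_le_of_isCompact (hD : IsOpen D) (hconn : IsConnected D)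
    {x₀ : EuclideanSpace ℂ (Fin n)} (hx₀ : x₀ ∈ D) {K : Set (EuclideanSpace ℂ (Fin n))}
    (hK : IsCompact K) (hKD : K ⊆ D) :
    ∃ C : ℝ, 0 ≤ C ∧ ∀ x ∈ K, kobayashi D x₀ x ≤ ENNReal.ofReal C := by
  refine hK.induction_on (p := fun K => ∃ C : ℝ, 0 ≤ C ∧ ∀ x ∈ K,
    kobayashi D x₀ x ≤ ENNReal.ofReal C) ⟨0, le_rfl, by simp⟩ ?_ ?_ ?_
  · rintro s t hst ⟨C, hC, h⟩
    exact ⟨C, hC, fun x hx => h x (hst hx)⟩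
  · rintro s t ⟨C, hC, h⟩ ⟨C', hC', h'⟩
    refine ⟨max C C', le_max_of_le_left hC, fun x hx => ?_⟩
    rcases hx with hx | hx
    · exact (h x hx).trans (ENNReal.ofReal_le_ofReal (le_max_left _ _))
    · exact (h' x hx).trans (ENNReal.ofReal_le_ofReal (le_max_right _ _))
  · intro x hx
    refine ⟨_, nhdsWithin_le_nhds (eventually_kobayashi_le_one hD (hKD hx)),
      (kobayashi D x₀ x + 1).toReal, ENNReal.toReal_nonneg, fun y hy => ?_⟩
    rw [ENNReal.ofReal_toReal (ENNReal.add_ne_top.2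
      ⟨(kobayashi_lt_top hD hconn hx₀ (hKD hx)).ne, ENNReal.one_ne_top⟩)]
    exact (kobayashi_triangle hx₀ (hKD hx) hy.1).trans (add_le_add le_rfl hy.2)

lemma exists_isCompact_of_le_infDist_frontier (hD : IsOpen D)
    {s : Set (EuclideanSpace ℂ (Fin n))} (hs : IsCompact s) {κ : ℝ} (hκ : 0 < κ) :
    ∃ K, IsCompact K ∧ K ⊆ D ∧ ∀ x ∈ D, x ∈ s → κ ≤ Metric.infDist x (frontier D) → x ∈ K := by
  refine ⟨s ∩ (closure D ∩ {x | κ ≤ Metric.infDist x (frontier D)}),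
    hs.inter_right (isClosed_closure.inter
      (isClosed_le continuous_const (Metric.continuous_infDist_pt _))), ?_,
    fun x hx hxs hxd => ⟨hxs, subset_closure hx, hxd⟩⟩
  rintro x ⟨-, hx, hxd⟩
  by_contra hxD
  have : x ∈ frontier D := by rw [hD.frontier_eq]; exact ⟨hx, hxD⟩
  have := Metric.infDist_zero_of_mem this
  rw [mem_ofPred_eq] at hxd
  linarith

end Finiteness

section Comparison

variable {n : ℕ} {D : Set (EuclideanSpace ℂ (Fin n))}

/-- Near a `C¹`-smooth boundary point the Kobayashi pseudodistance to a fixed point grows at most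
like `-c log d`, for any `c > 1 / 2`. -/
lemma IsC1BoundaryPoint.kobayashi_le_log {a x₀ : EuclideanSpace ℂ (Fin n)} (hD : IsOpen D)
    (hconn : IsConnected D) (ha : IsC1BoundaryPoint D a) (hx₀ : x₀ ∈ D) {c : ℝ} (hc : 1 / 2 < c) :
    ∃ (R C : ℝ), 0 < R ∧ 0 ≤ C ∧ ∀ z ∈ D, ‖z - a‖ < R → kobayashi D x₀ z ≤
      ENNReal.ofReal (c * max 0 (-Real.log (Metric.infDist z (frontier D))) + C) := by
  have hne : (frontier D).Nonempty := ⟨a, ha.1⟩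
  obtain ⟨c', hc', hcc⟩ := exists_between hc
  have hc0 : 0 < c' := by linarith
  obtain ⟨R₁, δ, hR₁, hδ, hloc⟩ := ha.kobayashi_le hD hc'
  have hθ0 : 0 < c' / c := div_pos hc0 (by linarith)
  obtain ⟨ν, R₂, hν, hR₂, hball⟩ := ha.exists_ball_subset hD hθ0 ((div_lt_one (by linarith)).2 hcc)
  set θ := c' / c with hθ
  set T := min (min (R₁ / 2) R₂) (1 / 2) with hT
  have hT0 : 0 < T := by positivity
  have hT1 : T ≤ R₁ / 2 := (min_le_left _ _).trans (min_le_left _ _)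
  have hT2 : T ≤ R₂ := (min_le_left _ _).trans (min_le_right _ _)
  have hT3 : T ≤ 1 / 2 := min_le_right _ _
  obtain ⟨K, hK, hKD, hKm⟩ := exists_isCompact_of_le_infDist_frontier hD
    (isCompact_closedBall a 1) (mul_pos hθ0 hT0)
  obtain ⟨C, hC, hCK⟩ := exists_kobayashi_le_of_isCompact hD hconn hx₀ hK hKD
  refine ⟨T, C, hT0, hC, fun z hz hza => ?_⟩
  set d := Metric.infDist z (frontier D) with hd
  have hd0 : 0 < d := infDist_frontier_pos hD hne hz
  have hda : d ≤ ‖z - a‖ := by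
    rw [← dist_eq_norm]; exact Metric.infDist_le_dist_of_mem ha.1
  have hpath : ∀ t ∈ Icc 0 T, z + t • ν ∈ D ∧
      θ * (d + t) ≤ Metric.infDist (z + t • ν) (frontier D) ∧ ‖z + t • ν - a‖ < 2 * T := by
    intro t ht
    have hb := hball z hz (hza.trans_le hT2) t ht.1 (ht.2.trans hT2)
    refine ⟨hb (Metric.mem_ball_self (mul_pos hθ0 (by linarith [ht.1]))),
      le_infDist_frontier_of_ball_subset hD hne hb, ?_⟩
    have h1 : ‖t • ν‖ ≤ t := by
      rw [norm_smul, Real.norm_of_nonneg ht.1]; exact mul_le_of_le_one_right ht.1 hν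
    have h2 := norm_add_le (z - a) (t • ν)
    rw [sub_add_eq_add_sub] at h2
    linarith [ht.2]
  obtain ⟨hpD, hpd, hpa⟩ := hpath T ⟨hT0.le, le_rfl⟩
  have hp : kobayashi D x₀ (z + T • ν) ≤ ENNReal.ofReal C := by
    refine hCK _ (hKm _ hpD ?_ (le_trans (by gcongr; linarith) hpd))
    rw [mem_closedBall_iff_norm]; linarith
  have hk := kobayashi_le_lintegral hD hne hc0.le hδ (G := {z ∈ D | ‖z - a‖ < R₁})
    (fun z h => h.1) (fun z h => hloc z h.1 h.2) (γ := fun t => z + t • ν) hT0.le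
    (fun s hs t ht hst => by
      rw [dist_eq_norm, add_sub_add_left_eq_sub, ← sub_smul, norm_smul, Real.norm_eq_abs,
        abs_sub_comm, abs_of_nonneg (sub_nonneg.2 hst)]
      exact mul_le_of_le_one_right (sub_nonneg.2 hst) hν)
    (fun t ht => ⟨(hpath t ht).1, (hpath t ht).2.2.trans_le (by linarith)⟩)
  simp only [zero_smul, add_zero] at hk
  have hint : ∫⁻ t in Ioc 0 T, (Metric.infEDist (z + t • ν) (frontier D))⁻¹ ≤
      ENNReal.ofReal (θ⁻¹ * (Real.log (d + T) - Real.log d)) := by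
    have e := lintegral_Ioc_inv_add_sub_left hT0.le hd0
    simp only [sub_zero] at e
    rw [ENNReal.ofReal_mul (inv_nonneg.2 hθ0.le), ← e,
      ← MeasureTheory.lintegral_const_mul' _ _ ENNReal.ofReal_ne_top]
    refine MeasureTheory.setLIntegral_mono' measurableSet_Ioc fun t ht => ?_
    rw [← ENNReal.ofReal_mul (inv_nonneg.2 hθ0.le), ← mul_inv]
    exact inv_infEDist_le_ofReal_inv hne (mul_pos hθ0 (by linarith [ht.1]))
      (hpath t ⟨ht.1.le, ht.2⟩).2.1
  have hlog : Real.log (d + T) ≤ 0 := Real.log_nonpos (by linarith) (by linarith)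
  calc kobayashi D x₀ z ≤ kobayashi D x₀ (z + T • ν) + kobayashi D (z + T • ν) z :=
        kobayashi_triangle hx₀ hpD hz
    _ ≤ ENNReal.ofReal C + ENNReal.ofReal c' * ENNReal.ofReal (θ⁻¹ * (Real.log (d + T) - Real.log d)) := by
        rw [kobayashi_comm hpD hz]
        exact add_le_add hp (hk.trans (by gcongr))
    _ = ENNReal.ofReal C + ENNReal.ofReal (c * (Real.log (d + T) - Real.log d)) := by
        rw [← ENNReal.ofReal_mul hc0.le, ← mul_assoc]
        congr 3
        rw [hθ]; field_simp
    _ ≤ ENNReal.ofReal C + ENNReal.ofReal (c * max 0 (-Real.log d)) := by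
        gcongr
        exact le_max_of_le_right (by linarith)
    _ = _ := by
        rw [add_comm, ENNReal.ofReal_add (mul_nonneg (by linarith) (le_max_left _ _)) hC]

/-- If the local bound `c₀ |dz| / d` of the Kobayashi pseudodistance holds on `G`, and `S ⊆ D`
lies deep inside `G`, then `k ≤ c h` for all pairs of points of `S` one of which is close to the
boundary. -/
lemma exists_kobayashi_le_mul_quasiHyperbolic (hD : IsOpen D) (hne : (frontier D).Nonempty)
    {S G : Set (EuclideanSpace ℂ (Fin n))} (hSD : S ⊆ D) {x₀ : EuclideanSpace ℂ (Fin n)}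
    (hx₀ : x₀ ∈ D) {c₀ c δ C κ : ℝ} (hc₀ : 0 < c₀) (hc : c₀ < c) (hδ : 0 < δ) (hC : 0 ≤ C)
    (hκ : 0 < κ)
    (hloc : ∀ z ∈ D, z ∈ G → ∀ w ∈ D, ‖z - w‖ ≤ δ * Metric.infDist z (frontier D) →
      kobayashi D z w ≤
        ENNReal.ofReal (c₀ * (‖z - w‖ / (Metric.infDist z (frontier D) + ‖z - w‖))))
    (hlog : ∀ z ∈ S, kobayashi D x₀ z ≤
      ENNReal.ofReal (c₀ * max 0 (-Real.log (Metric.infDist z (frontier D))) + C))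
    (hexit : ∀ z ∈ S, ∀ x ∈ D, x ∉ G → κ ≤ Metric.infDist z (frontier D) + ‖z - x‖) :
    ∃ η > 0, ∀ z ∈ S, ∀ w ∈ S, Metric.infDist z (frontier D) < η →
      kobayashi D z w ≤ ENNReal.ofReal c * quasiHyperbolic D z w := by
  set M := (2 * C + 2 * c * |Real.log κ|) / (c - c₀) with hM
  refine ⟨Real.exp (-M), Real.exp_pos _, fun z hz w hw hzη => ?_⟩
  have hc0 : 0 < c := hc₀.trans hc
  rw [mul_comm, ← ENNReal.div_le_iff_le_mul (Or.inl (by simpa using hc0))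
    (Or.inl ENNReal.ofReal_ne_top)]
  refine le_iInf fun L => le_iInf fun γ => le_iInf fun h => ?_
  obtain ⟨hL, hγ, hγD, h0, h1⟩ := h
  rw [ENNReal.div_le_iff_le_mul (Or.inl (by simpa using hc0))
    (Or.inl ENNReal.ofReal_ne_top), mul_comm]
  have hlip : ∀ s ∈ Icc 0 L, ∀ t ∈ Icc 0 L, s ≤ t → dist (γ s) (γ t) ≤ t - s :=
    fun s hs t ht hst => hγ.dist_le hs ht hst
  by_cases hG : MapsTo γ (Icc 0 L) G
  · have := kobayashi_le_lintegral hD hne (G := D ∩ G) hc₀.le hδ inter_subset_left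
      (fun z h => hloc z h.1 h.2) hL hlip (fun t ht => ⟨hγD ht, hG ht⟩)
    rw [h0, h1] at this
    refine this.trans (mul_le_mul' (ENNReal.ofReal_le_ofReal hc.le) ?_)
    exact MeasureTheory.lintegral_mono_set Ioc_subset_Icc_self
  · obtain ⟨s, hs, hsG⟩ : ∃ s ∈ Icc 0 L, γ s ∉ G := by
      simpa [MapsTo, and_assoc] using hG
    have hlow := ofReal_log_add_le_lintegral hD hne hs hlip
      (by rw [h0]; exact hSD hz) (by rw [h1]; exact hSD hw)
    rw [h0, h1] at hlow
    set p := Metric.infDist z (frontier D) with hp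
    set q := Metric.infDist w (frontier D) with hq
    have hp0 : 0 < p := infDist_frontier_pos hD hne (hSD hz)
    have hq0 : 0 < q := infDist_frontier_pos hD hne (hSD hw)
    have hps : κ ≤ p + s := by
      have := hexit z hz _ (hγD hs) hsG
      have h2 := hlip 0 ⟨le_rfl, hL⟩ s hs hs.1
      rw [h0, dist_eq_norm] at h2
      linarith
    have hqs : κ ≤ q + (L - s) := by
      have := hexit w hw _ (hγD hs) hsG
      have h2 := hlip s hs L ⟨hL, le_rfl⟩ hs.2
      rw [h1, dist_comm, dist_eq_norm] at h2
      linarith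
    have hlogκ : ∀ x y : ℝ, 0 < x → 0 ≤ y → κ ≤ x + y →
        max 0 (-Real.log x) - |Real.log κ| ≤ Real.log (x + y) - Real.log x := by
      intro x y hx hy hxy
      have i1 := Real.log_le_log hκ hxy
      have i2 := Real.log_le_log hx (le_add_of_nonneg_right hy : x ≤ x + y)
      have i3 := neg_abs_le (Real.log κ)
      have i4 := abs_nonneg (Real.log κ)
      rcases max_cases 0 (-Real.log x) with ⟨h, _⟩ | ⟨h, _⟩ <;> rw [h] <;> linarith
    have hP : M ≤ max 0 (-Real.log p) := by
      refine le_max_of_le_right ?_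
      have := (Real.log_le_log hp0 hzη.le)
      rw [Real.log_exp] at this
      linarith
    have hQ : 0 ≤ max 0 (-Real.log q) := le_max_left _ _
    have hP0 : 0 ≤ max 0 (-Real.log p) := le_max_left _ _
    have l1 := hlogκ p s hp0 hs.1 hps
    have l2 := hlogκ q (L - s) hq0 (by linarith [hs.2]) hqs
    have k1 := hlog z hz
    have k2 := hlog w hw
    rw [← hp] at k1
    rw [← hq] at k2
    set P := max 0 (-Real.log p)
    set Q := max 0 (-Real.log q)
    have hreal : (c₀ * P + C) + (c₀ * Q + C) ≤
        c * ((P - |Real.log κ|) + (Q - |Real.log κ|)) := by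
      have hcc : 0 < c - c₀ := by linarith
      have : (c - c₀) * M = 2 * C + 2 * c * |Real.log κ| := by rw [hM]; field_simp
      have i1 := mul_le_mul_of_nonneg_left hP hcc.le
      have i2 := mul_nonneg hcc.le hQ
      linarith
    calc kobayashi D z w ≤ kobayashi D z x₀ + kobayashi D x₀ w :=
          kobayashi_triangle (hSD hz) hx₀ (hSD hw)
      _ ≤ ENNReal.ofReal (c₀ * P + C) + ENNReal.ofReal (c₀ * Q + C) := by
          rw [kobayashi_comm (hSD hz) hx₀]; exact add_le_add k1 k2
      _ = ENNReal.ofReal ((c₀ * P + C) + (c₀ * Q + C)) :=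
          (ENNReal.ofReal_add (by positivity) (by positivity)).symm
      _ ≤ ENNReal.ofReal (c * ((P - |Real.log κ|) + (Q - |Real.log κ|))) :=
          ENNReal.ofReal_le_ofReal hreal
      _ ≤ ENNReal.ofReal c * (ENNReal.ofReal (P - |Real.log κ|) +
            ENNReal.ofReal (Q - |Real.log κ|)) := by
          rw [ENNReal.ofReal_mul hc0.le]
          gcongr
          exact ENNReal.ofReal_add_le
      _ ≤ _ := by
          gcongr
          exact (add_le_add (ENNReal.ofReal_le_ofReal l1) (ENNReal.ofReal_le_ofReal l2)).trans hlow

lemma IsC1BoundaryPoint.exists_kobayashi_le_mul {a : EuclideanSpace ℂ (Fin n)} (hD : IsOpen D)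
    (hconn : IsConnected D) (ha : IsC1BoundaryPoint D a) {c : ℝ} (hc : 1 / 2 < c) :
    ∃ R > 0, ∀ z ∈ D, ‖z - a‖ < R → ∀ w ∈ D, ‖w - a‖ < R →
      kobayashi D z w ≤ ENNReal.ofReal c * quasiHyperbolic D z w := by
  have hne : (frontier D).Nonempty := ⟨a, ha.1⟩
  obtain ⟨x₀, hx₀⟩ := hconn.nonempty
  obtain ⟨c₀, hc₀, hcc⟩ := exists_between hc
  obtain ⟨R₁, δ, hR₁, hδ, hloc⟩ := ha.kobayashi_le hD hc₀
  obtain ⟨R₂, C, hR₂, hC, hlog⟩ := ha.kobayashi_le_log hD hconn hx₀ hc₀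
  obtain ⟨η, hη, h⟩ := exists_kobayashi_le_mul_quasiHyperbolic hD hne
    (S := {z ∈ D | ‖z - a‖ < min (R₁ / 2) R₂}) (G := {z | ‖z - a‖ < R₁}) (fun z h => h.1) hx₀
    (by linarith) hcc hδ hC (half_pos hR₁) (fun z hz hG => hloc z hz hG)
    (fun z hz => hlog z hz.1 (hz.2.trans_le (min_le_right _ _)))
    (fun z hz x _ hxG => by
      have hz2 := hz.2.trans_le (min_le_left _ _)
      have h1 : R₁ ≤ ‖x - a‖ := not_lt.1 hxG
      have h2 := norm_sub_le_norm_sub_add_norm_sub x z a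
      rw [norm_sub_rev x z] at h2
      have h3 : 0 ≤ Metric.infDist z (frontier D) := Metric.infDist_nonneg
      linarith)
  refine ⟨min η (min (R₁ / 2) R₂), by positivity, fun z hz hza w hw hwa =>
    h z ⟨hz, hza.trans_le (min_le_right _ _)⟩ w ⟨hw, hwa.trans_le (min_le_right _ _)⟩ ?_⟩
  refine lt_of_le_of_lt ?_ (hza.trans_le (min_le_left _ _))
  rw [← dist_eq_norm]
  exact Metric.infDist_le_dist_of_mem ha.1

/-- On a bounded `C¹`-smooth domain the local estimates are uniform near the boundary. -/
lemma exists_uniform_kobayashi_le (hD : IsOpen D) (hconn : IsConnected D)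
    (hbdd : Bornology.IsBounded D) (hsm : ∀ a ∈ frontier D, IsC1BoundaryPoint D a)
    {x₀ : EuclideanSpace ℂ (Fin n)} (hx₀ : x₀ ∈ D) {c : ℝ} (hc : 1 / 2 < c) :
    ∃ (V : Set (EuclideanSpace ℂ (Fin n))) (δ C : ℝ), IsOpen V ∧ frontier D ⊆ V ∧ 0 < δ ∧ 0 ≤ C ∧
      ∀ z ∈ D, z ∈ V → (∀ w ∈ D, ‖z - w‖ ≤ δ * Metric.infDist z (frontier D) →
        kobayashi D z w ≤
          ENNReal.ofReal (c * (‖z - w‖ / (Metric.infDist z (frontier D) + ‖z - w‖)))) ∧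
        kobayashi D x₀ z ≤
          ENNReal.ofReal (c * max 0 (-Real.log (Metric.infDist z (frontier D))) + C) := by
  have hcomp : IsCompact (frontier D) :=
    hbdd.isCompact_closure.of_isClosed_subset isClosed_frontier frontier_subset_closure
  refine hcomp.induction_on (p := fun F => ∃ (V : Set (EuclideanSpace ℂ (Fin n))) (δ C : ℝ),
    IsOpen V ∧ F ⊆ V ∧ 0 < δ ∧ 0 ≤ C ∧
      ∀ z ∈ D, z ∈ V → (∀ w ∈ D, ‖z - w‖ ≤ δ * Metric.infDist z (frontier D) →
        kobayashi D z w ≤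
          ENNReal.ofReal (c * (‖z - w‖ / (Metric.infDist z (frontier D) + ‖z - w‖)))) ∧
        kobayashi D x₀ z ≤
          ENNReal.ofReal (c * max 0 (-Real.log (Metric.infDist z (frontier D))) + C))
    ⟨∅, 1, 0, isOpen_empty, Subset.rfl, one_pos, le_rfl, by simp⟩ ?_ ?_ ?_
  · rintro s t hst ⟨V, δ, C, hV, htV, h⟩
    exact ⟨V, δ, C, hV, hst.trans htV, h⟩
  · rintro s t ⟨V, δ, C, hV, hsV, hδ, hC, h⟩ ⟨V', δ', C', hV', htV', hδ', hC', h'⟩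
    refine ⟨V ∪ V', min δ δ', max C C', hV.union hV', union_subset_union hsV htV', by positivity,
      le_max_of_le_left hC, fun z hz hzV => ?_⟩
    rcases hzV with hzV | hzV
    · refine ⟨fun w hw hzw => (h z hz hzV).1 w hw (hzw.trans ?_), (h z hz hzV).2.trans ?_⟩
      · exact mul_le_mul_of_nonneg_right (min_le_left _ _) Metric.infDist_nonneg
      · exact ENNReal.ofReal_le_ofReal (add_le_add le_rfl (le_max_left _ _))
    · refine ⟨fun w hw hzw => (h' z hz hzV).1 w hw (hzw.trans ?_), (h' z hz hzV).2.trans ?_⟩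
      · exact mul_le_mul_of_nonneg_right (min_le_right _ _) Metric.infDist_nonneg
      · exact ENNReal.ofReal_le_ofReal (add_le_add le_rfl (le_max_right _ _))
  · intro a ha
    obtain ⟨R₁, δ, hR₁, hδ, hloc⟩ := (hsm a ha).kobayashi_le hD hc
    obtain ⟨R₂, C, hR₂, hC, hlog⟩ := (hsm a ha).kobayashi_le_log hD hconn hx₀ hc
    refine ⟨Metric.ball a (min R₁ R₂), nhdsWithin_le_nhds (Metric.ball_mem_nhds a (by positivity)),
      Metric.ball a (min R₁ R₂), δ, C, Metric.isOpen_ball, Subset.rfl, hδ, hC, fun z hz hzV => ?_⟩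
    rw [mem_ball_iff_norm] at hzV
    exact ⟨hloc z hz (hzV.trans_le (min_le_left _ _)), hlog z hz (hzV.trans_le (min_le_right _ _))⟩

lemma exists_kobayashi_le_mul_of_isBounded (hD : IsOpen D) (hconn : IsConnected D)
    (hbdd : Bornology.IsBounded D) (hne : (frontier D).Nonempty)
    (hsm : ∀ a ∈ frontier D, IsC1BoundaryPoint D a) {c : ℝ} (hc : 1 / 2 < c) :
    ∃ η > 0, ∀ z ∈ D, Metric.infDist z (frontier D) < η → ∀ w ∈ D,
      kobayashi D z w ≤ ENNReal.ofReal c * quasiHyperbolic D z w := by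
  obtain ⟨x₀, hx₀⟩ := hconn.nonempty
  obtain ⟨c₀, hc₀, hcc⟩ := exists_between hc
  have hc₀pos : 0 < c₀ := by linarith
  obtain ⟨V, δ, C, hV, hFV, hδ, hC, h⟩ := exists_uniform_kobayashi_le hD hconn hbdd hsm hx₀ hc₀
  have hcomp : IsCompact (frontier D) :=
    hbdd.isCompact_closure.of_isClosed_subset isClosed_frontier frontier_subset_closure
  obtain ⟨κ, hκ, hκV⟩ := hcomp.exists_thickening_subset_open hV hFV
  have hmem : ∀ z, Metric.infDist z (frontier D) < κ → z ∈ V := fun z hz =>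
    hκV ((Metric.mem_thickening_iff_infDist_lt hne).2 hz)
  obtain ⟨K, hK, hKD, hKm⟩ := exists_isCompact_of_le_infDist_frontier hD
    hbdd.isCompact_closure hκ
  obtain ⟨C', hC', hCK⟩ := exists_kobayashi_le_of_isCompact hD hconn hx₀ hK hKD
  obtain ⟨η, hη, hfin⟩ := exists_kobayashi_le_mul_quasiHyperbolic hD hne
    (S := D) (G := {z | Metric.infDist z (frontier D) < κ}) Subset.rfl hx₀
    hc₀pos hcc hδ (le_max_of_le_left hC : 0 ≤ max C C') hκ
    (fun z hz hG => (h z hz (hmem z hG)).1)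
    (fun z hz => by
      rcases lt_or_ge (Metric.infDist z (frontier D)) κ with hlt | hge
      · exact (h z hz (hmem z hlt)).2.trans
          (ENNReal.ofReal_le_ofReal (add_le_add le_rfl (le_max_left _ _)))
      · refine (hCK z (hKm z hz (subset_closure hz) hge)).trans (ENNReal.ofReal_le_ofReal ?_)
        exact (le_max_right C C').trans
          (le_add_of_nonneg_left (mul_nonneg hc₀pos.le (le_max_left _ _))))
    (fun z hz x _ hxG => by
      have h1 : κ ≤ Metric.infDist x (frontier D) := not_lt.1 hxG
      have h2 := Metric.infDist_le_infDist_add_dist (s := frontier D) (x := x) (y := z)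
      rw [dist_comm, dist_eq_norm] at h2
      linarith)
  exact ⟨η, hη, fun z hz hzη w hw => hfin z hz w hw hzη⟩

end Comparison

theorem mainTheorem5 (n : ℕ) (D : Set (EuclideanSpace ℂ (Fin n)))
    (hD_open : IsOpen D) (hD_conn : IsConnected D) :
    (∀ a : EuclideanSpace ℂ (Fin n), IsC1BoundaryPoint D a →
      limsup (fun p : EuclideanSpace ℂ (Fin n) × EuclideanSpace ℂ (Fin n) =>
          kobayashi D p.1 p.2 / quasiHyperbolic D p.1 p.2)
        (𝓝[{p | p.1 ∈ D ∧ p.2 ∈ D ∧ p.1 ≠ p.2}] (a, a)) ≤ 1 / 2) ∧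
    (Bornology.IsBounded D → (∀ a ∈ frontier D, IsC1BoundaryPoint D a) →
      limsup (fun z : EuclideanSpace ℂ (Fin n) =>
          ⨆ w ∈ D \ {z}, kobayashi D z w / quasiHyperbolic D z w)
        (𝓝ˢ (frontier D) ⊓ 𝓟 D) ≤ 1 / 2) := by
  have key : ∀ x : ℝ≥0∞, (∀ c : ℝ, 1 / 2 < c → x ≤ ENNReal.ofReal c) → x ≤ 1 / 2 := by
    intro x hx
    have h2 : (1 / 2 : ℝ≥0∞) = ENNReal.ofReal (1 / 2) := by
      rw [ENNReal.ofReal_div_of_pos two_pos]; simp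
    rw [h2]
    have ht : Tendsto ENNReal.ofReal (𝓝[>] (1 / 2)) (𝓝 (ENNReal.ofReal (1 / 2))) :=
      (ENNReal.continuous_ofReal.tendsto _).mono_left nhdsWithin_le_nhds
    refine ge_of_tendsto ht ?_
    filter_upwards [self_mem_nhdsWithin] with c hc
    exact hx c hc
  refine ⟨fun a ha => key _ fun c hc => ?_, fun hbdd hsm => key _ fun c hc => ?_⟩
  · obtain ⟨R, hR, h⟩ := ha.exists_kobayashi_le_mul hD_open hD_conn hc
    refine limsup_le_of_le (by isBoundedDefault) ?_
    have hn : Metric.ball a R ×ˢ Metric.ball a R ∈ 𝓝 (a, a) :=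
      prod_mem_nhds (Metric.ball_mem_nhds a hR) (Metric.ball_mem_nhds a hR)
    filter_upwards [nhdsWithin_le_nhds hn, self_mem_nhdsWithin] with p hp hpD
    exact ENNReal.div_le_of_le_mul (h _ hpD.1 (mem_ball_iff_norm.1 hp.1) _ hpD.2.1
      (mem_ball_iff_norm.1 hp.2))
  · rcases (frontier D).eq_empty_or_nonempty with he | hne
    · simp [he]
    obtain ⟨η, hη, h⟩ := exists_kobayashi_le_mul_of_isBounded hD_open hD_conn hbdd hne hsm hc
    refine limsup_le_of_le (by isBoundedDefault) ?_
    have hn : {z | Metric.infDist z (frontier D) < η} ∈ 𝓝ˢ (frontier D) :=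
      (isOpen_lt (Metric.continuous_infDist_pt _) continuous_const).mem_nhdsSet.2 fun z hz => by
        simpa [Metric.infDist_zero_of_mem hz] using hη
    filter_upwards [mem_inf_of_left hn, mem_inf_of_right (mem_principal_self D)] with z hz hzD
    exact iSup₂_le fun w hw => ENNReal.div_le_of_le_mul (h z hzD hz w hw.1)
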